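/- **Model.** Consider a power network with buses $i\in[n]=\{1,\dots,n\}$, a real matrix $(B_{ij})$ (the imaginary part of the admittance matrix; $B_{ij}=0$ if $i,j$ are not joined by a line) and line capacities $F^{\max}_{ij}\ge 0$. Bus $i$ has a storage with efficiency $\lambda_i\in(0,1]$, level bounds $S_i^{\min},S_i^{\max}$, control bounds $U_i^{\min},U_i^{\max}$ and a given initial level $s_i(1)\in[S_i^{\min},S_i^{\max}]$. It also has a random net supply $\delta_i(t)$, a random price $p_i(t)$ and a measurable cost function $g_i(r;p)$ that is convex in $r\in\mathbb R$ for every $p\in[P_i^{\min},P_i^{\max}]$. The storages are feasible and controllable: $$\lambda_iS_i^{\min}+U_i^{\max}\ge S_i^{\min},\quad \lambda_iS_i^{\max}+U_i^{\min}\le S_i^{\max},\quad \lambda_iS_i^{\max}+U_i^{\max}\ge S_i^{\max},\quad \lambda_iS_i^{\min}+U_i^{\min}\le S_i^{\min}.$$ The disturbance vectors $(\delta(t),p(t))$, $t=1,2,\dots$, are i.i.d. over time with $\delta_i(t)\in[\delta_i^{\min},\delta_i^{\max}]$ and $p_i(t)\in[P_i^{\min},P_i^{\max}]$ almost surely, and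 $g_i(r;p_i(t))$ is integrable for every fixed $r$. The information available in period $t$ is given by a filtration $(\mathcal F_t)$ such that $(\delta(t),p(t))$ is $\mathcal F_t$-measurable and $(\delta(t+1),p(t+1))$ is independent of $\mathcal F_t$. **Stochastic network storage problem.** A decision in period $t$ is a tuple $(u(t),r(t),\theta(t),f(t))$ with $u(t),r(t),\theta(t)\in\mathbb R^n$, $f(t)\in\mathbb R^{n\times n}$. It satisfies the period constraints if for all $i,j$ $$\delta_i(t)+r_i(t)=u_i(t)+\sum_{j=1}^n f_{ij}(t),\quad U_i^{\min}\le u_i(t)\le U_i^{\max},\quad B_{ij}(\theta_i(t)-\theta_j(t))=f_{ij}(t),\quad |f_{ij}(t)|\le F^{\max}_{ij}.$$ Storage levels evolve by $s_i(t+1)=\lambda_is_i(t)+u_i(t)$. An $(\mathcal F_t)$-adapted sequence of decisions is admissible if almost surely the period constraints and $S_i^{\min}\le s_i(t)\le S_i^{\max}$ hold for all $i,t$. Its long-run average expected cost is $$J=\limsup_{T\to\infty}\frac1T\,\mathbb E\sum_{t=1}^T\sum_{i=1}^n g_i(r_i(t);p_i(t)),$$ and $J^\star$ is the infimum of $J$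 over all admissible sequences. **Parameters.** Let $Dg_i$ be the set of all subgradients at $u$ of the convex function $v\mapsto g_i\big(v-\delta_i+\sum_jf_{ij};p_i\big)$ on $\mathbb R$, over all $u\in[U_i^{\min},U_i^{\max}]$, $|f_{kj}|\le F^{\max}_{kj}$ (all $k,j$), $\delta_i\in[\delta_i^{\min},\delta_i^{\max}]$, $p_i\in[P_i^{\min},P_i^{\max}]$. Let $\underline Dg_i,\overline Dg_i\in\mathbb R$ satisfy $\underline Dg_i\le\inf Dg_i\le\sup Dg_i\le\overline Dg_i$. Put $$W_i^{\max}=\frac{(S_i^{\max}-S_i^{\min})-(U_i^{\max}-U_i^{\min})}{\overline Dg_i-\underline Dg_i}\quad(=+\infty\text{ if }\overline Dg_i=\underline Dg_i),$$ $$\Gamma_i^{\min}=\frac{-W_i\underline Dg_i+U_i^{\max}-S_i^{\max}}{\lambda_i},\qquad \Gamma_i^{\max}=\frac{-W_i\overline Dg_i-S_i^{\min}+U_i^{\min}}{\lambda_i},$$ $$M_i(\Gamma)=\tfrac12\max\{(U_i^{\min}+(1-\lambda_i)\Gamma)^2,(U_i^{\max}+(1-\lambda_i)\Gamma)^2\}+\lambda_i(1-\lambda_i)\max\{(S_i^{\min}+\Gamma)^2,(S_i^{\max}+\Gamma)^2\}.$$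 **Online Modified Greedy policy.** An adapted sequence of decisions is generated by the policy with parameters $W,\Gamma$ if almost surely in each period $t$ the decision is an optimal solution of the deterministic program: minimize $\sum_{i}\big[\frac{\lambda_i}{W_i}(s_i(t)+\Gamma_i)u_i+g_i(r_i;p_i(t))\big]$ over all $(u,r,\theta,f)$ satisfying the period constraints for $\delta(t)$ (no constraint on storage levels; ties are broken arbitrarily). **Theorem.** Let $0<W_i\le W_i^{\max}$ and $\Gamma_i^{\min}\le\Gamma_i\le\Gamma_i^{\max}$ for all $i$. Then the deterministic program has an optimal solution for all values of the storage levels, net supplies, and prices $p_i\in[P_i^{\min},P_i^{\max}]$. For every sequence of decisions generated by the Online Modified Greedy policy, almost surely $S_i^{\min}\le s_i(t)\le S_i^{\max}$ for all $i,t$. Moreover the sequence is admissible, all its costs $g_i(r_i(t);p_i(t))$ are integrable, and its long-run average expected cost is at most $$J^\star+\sum_{i=1}^n\frac{M_i(\Gamma_i)}{W_i}.$$ -/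

import Mathlib

open MeasureTheory ProbabilityTheory Filter Set

/-- A power network with `n` buses (`Fin n`), each carrying a storage, a random net supply and a
convex generation/curtailment cost.  A pair of buses that is not joined by a line has `B i j = 0`. -/
structure StorageNetwork (n : ℕ) where
  /-- storage efficiencies -/
  lam : Fin n → ℝ
  Smin : Fin n → ℝ
  Smax : Fin n → ℝ
  Umin : Fin n → ℝ
  Umax : Fin n → ℝ
  /-- range of the net supplies -/
  δmin : Fin n → ℝ
  δmax : Fin n → ℝ
  /-- range of the price parameters -/
  Pmin : Fin n → ℝ
  Pmax : Fin n → ℝ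
  /-- imaginary part of the admittance matrix -/
  B : Matrix (Fin n) (Fin n) ℝ
  /-- line capacities -/
  Fmax : Fin n → Fin n → ℝ
  /-- `g i r p` is the cost at bus `i` of the net generation `r` under the price parameter `p` -/
  g : Fin n → ℝ → ℝ → ℝ
  /-- the storage levels at the beginning of the first period -/
  sInit : Fin n → ℝ
  lam_pos : ∀ i, 0 < lam i
  lam_le_one : ∀ i, lam i ≤ 1
  Fmax_nonneg : ∀ i j, 0 ≤ Fmax i j
  g_convex : ∀ i, ∀ p ∈ Icc (Pmin i) (Pmax i), ConvexOn ℝ univ (fun r => g i r p)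
  g_measurable : ∀ i, Measurable (fun x : ℝ × ℝ => g i x.1 x.2)
  sInit_mem : ∀ i, sInit i ∈ Icc (Smin i) (Smax i)

/-- The decision taken in one period: storage controls `u`, net generations `r`, voltage angles
`θ` and line flows `f`. -/
structure Decision (n : ℕ) where
  u : Fin n → ℝ
  r : Fin n → ℝ
  θ : Fin n → ℝ
  f : Fin n → Fin n → ℝ

/-- A decision in every period and every scenario.  Period `t : ℕ` is the `(t + 1)`-st period. -/
structure ControlProcess (n : ℕ) (Ω : Type*) where
  u : ℕ → Ω → Fin n → ℝ
  r : ℕ → Ω → Fin n → ℝ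
  θ : ℕ → Ω → Fin n → ℝ
  f : ℕ → Ω → Fin n → Fin n → ℝ

namespace ControlProcess

variable {n : ℕ} {Ω : Type*}

/-- The decision of period `t` in scenario `ω`. -/
def decision (c : ControlProcess n Ω) (t : ℕ) (ω : Ω) : Decision n :=
  ⟨c.u t ω, c.r t ω, c.θ t ω, c.f t ω⟩

/-- The decision of period `t` uses only the information `ℱ t`. -/
structure IsAdapted {mΩ : MeasurableSpace Ω} (c : ControlProcess n Ω) (ℱ : Filtration ℕ mΩ) :
    Prop where
  u : ∀ t, Measurable[ℱ t] (c.u t)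
  r : ∀ t, Measurable[ℱ t] (c.r t)
  θ : ∀ t, Measurable[ℱ t] (c.θ t)
  f : ∀ t, Measurable[ℱ t] (c.f t)

end ControlProcess

namespace StorageNetwork

variable {n : ℕ} (N : StorageNetwork n) {Ω : Type*}

/-- Every storage is feasible and controllable. -/
structure FeasibleControllable : Prop where
  feas_lower : ∀ i, N.Smin i ≤ N.lam i * N.Smin i + N.Umax i
  feas_upper : ∀ i, N.lam i * N.Smax i + N.Umin i ≤ N.Smax i
  contr_upper : ∀ i, N.Smax i ≤ N.lam i * N.Smax i + N.Umax i
  contr_lower : ∀ i, N.lam i * N.Smin i + N.Umin i ≤ N.Smin i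

/-- The disturbances `(δ t, p t)` (vectors over the buses) are i.i.d. over time and have compact
support.  `ℱ t` is the information available in period `t`: it contains all disturbances up to
period `t` (and possibly randomization), and future disturbances are independent of it. -/
structure IIDDisturbances {mΩ : MeasurableSpace Ω} (μ : Measure Ω) (ℱ : Filtration ℕ mΩ)
    (δ p : ℕ → Ω → Fin n → ℝ) : Prop where
  δ_adapted : ∀ t, Measurable[ℱ t] (δ t)
  p_adapted : ∀ t, Measurable[ℱ t] (p t)
  identDistrib : ∀ t, IdentDistrib (fun ω => (δ t ω, p t ω)) (fun ω => (δ 0 ω, p 0 ω)) μ μ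
  indep : ∀ t, Indep (ℱ t)
    (MeasurableSpace.comap (fun ω => (δ (t + 1) ω, p (t + 1) ω)) inferInstance) μ
  δ_mem : ∀ t, ∀ᵐ ω ∂μ, ∀ i, δ t ω i ∈ Icc (N.δmin i) (N.δmax i)
  p_mem : ∀ t, ∀ᵐ ω ∂μ, ∀ i, p t ω i ∈ Icc (N.Pmin i) (N.Pmax i)

/-- The constraints of a single period, for the net supplies `δ`, without those on the storage
levels. -/
structure PeriodFeasible (δ : Fin n → ℝ) (d : Decision n) : Prop where
  balance : ∀ i, δ i + d.r i = d.u i + ∑ j, d.f i j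
  control : ∀ i, d.u i ∈ Icc (N.Umin i) (N.Umax i)
  flow : ∀ i j, N.B i j * (d.θ i - d.θ j) = d.f i j
  capacity : ∀ i j, d.f i j ∈ Icc (-N.Fmax i j) (N.Fmax i j)

/-- The storage levels that result from the controls `u`. -/
def storage (u : ℕ → Ω → Fin n → ℝ) : ℕ → Ω → Fin n → ℝ
  | 0 => fun _ => N.sInit
  | t + 1 => fun ω i => N.lam i * storage u t ω i + u t ω i

/-- The control processes over which the stochastic network storage problem is minimized. -/
structure Admissible {mΩ : MeasurableSpace Ω} (μ : Measure Ω) (ℱ : Filtration ℕ mΩ)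
    (δ : ℕ → Ω → Fin n → ℝ) (c : ControlProcess n Ω) : Prop where
  adapted : c.IsAdapted ℱ
  feasible : ∀ t, ∀ᵐ ω ∂μ, N.PeriodFeasible (δ t ω) (c.decision t ω)
  storage_mem : ∀ t, ∀ᵐ ω ∂μ, ∀ i, N.storage c.u t ω i ∈ Icc (N.Smin i) (N.Smax i)

/-- The expected cost per period over the first `T` periods. -/
noncomputable def averageCost {mΩ : MeasurableSpace Ω} (μ : Measure Ω) (p : ℕ → Ω → Fin n → ℝ)
    (c : ControlProcess n Ω) (T : ℕ) : ℝ :=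
  (1 / (T : ℝ)) * ∫ ω, ∑ t ∈ Finset.range T, ∑ i, N.g i (c.r t ω i) (p t ω i) ∂μ

/-- The long-run average expected cost (as an upper limit, so that it is defined for all control
processes). -/
noncomputable def longRunCost {mΩ : MeasurableSpace Ω} (μ : Measure Ω) (p : ℕ → Ω → Fin n → ℝ)
    (c : ControlProcess n Ω) : EReal :=
  limsup (fun T : ℕ => ((N.averageCost μ p c T : ℝ) : EReal)) atTop

/-- The optimal cost of the infinite-horizon stochastic network storage problem. -/
noncomputable def optimalCost {mΩ : MeasurableSpace Ω} (μ : Measure Ω) (ℱ : Filtration ℕ mΩ)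
    (δ p : ℕ → Ω → Fin n → ℝ) : EReal :=
  ⨅ (c : ControlProcess n Ω) (_ : N.Admissible μ ℱ δ c), N.longRunCost μ p c

/-- The subgradients in `u` of the convex function `u ↦ g i (u - δ + ∑ j, f i j) p`, collected over
all `u`, `f`, `δ`, `p` within their bounds. -/
def subgradients (i : Fin n) : Set ℝ :=
  {α | ∃ u ∈ Icc (N.Umin i) (N.Umax i), ∃ f : Fin n → Fin n → ℝ,
    (∀ k j, f k j ∈ Icc (-N.Fmax k j) (N.Fmax k j)) ∧
    ∃ δ ∈ Icc (N.δmin i) (N.δmax i), ∃ p ∈ Icc (N.Pmin i) (N.Pmax i),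
    ∀ u' : ℝ, N.g i (u - δ + ∑ j, f i j) p + α * (u' - u) ≤ N.g i (u' - δ + ∑ j, f i j) p}

/-- The lower end of the interval of admissible shifts at bus `i`; `Dlo` is the lower bound of the
subgradients. -/
noncomputable def Γmin (i : Fin n) (Dlo W : ℝ) : ℝ :=
  (1 / N.lam i) * (-W * Dlo + N.Umax i - N.Smax i)

/-- The upper end of the interval of admissible shifts at bus `i`; `Dup` is the upper bound of the
subgradients. -/
noncomputable def Γmax (i : Fin n) (Dup W : ℝ) : ℝ :=
  (1 / N.lam i) * (-W * Dup - N.Smin i + N.Umin i)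

open Classical in
/-- The largest admissible weight at bus `i`, which is infinite if the two bounds `Dlo`, `Dup` of
the subgradients coincide. -/
noncomputable def Wmax (i : Fin n) (Dlo Dup : ℝ) : EReal :=
  if Dlo = Dup then ⊤
  else ((((N.Smax i - N.Smin i) - (N.Umax i - N.Umin i)) / (Dup - Dlo) : ℝ) : EReal)

/-- The quadratic bound coming from the storage control. -/
noncomputable def Mu (i : Fin n) (Γ : ℝ) : ℝ :=
  (1 / 2) * max ((N.Umin i + (1 - N.lam i) * Γ) ^ 2) ((N.Umax i + (1 - N.lam i) * Γ) ^ 2)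

/-- The quadratic bound coming from the storage level. -/
noncomputable def Ms (i : Fin n) (Γ : ℝ) : ℝ :=
  max ((N.Smin i + Γ) ^ 2) ((N.Smax i + Γ) ^ 2)

/-- The numerator of the sub-optimality bound at bus `i`. -/
noncomputable def M (i : Fin n) (Γ : ℝ) : ℝ :=
  N.Mu i Γ + N.lam i * (1 - N.lam i) * N.Ms i Γ

/-- The objective of the deterministic program that is solved online. -/
noncomputable def onlineObjective (W Γ s p : Fin n → ℝ) (d : Decision n) : ℝ :=
  ∑ i, (N.lam i / W i * (s i + Γ i) * d.u i + N.g i (d.r i) (p i))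

/-- `d` is an optimal solution of the online program for the storage levels `s`, the net supplies
`δ` and the prices `p`. -/
def IsOnlineSolution (W Γ s δ p : Fin n → ℝ) (d : Decision n) : Prop :=
  N.PeriodFeasible δ d ∧
    IsMinOn (N.onlineObjective W Γ s p) {d' | N.PeriodFeasible δ d'} d

/-- `c` is generated by the Online Modified Greedy policy: it is non-anticipating and, in every
period, solves the online program for the current storage levels and disturbances (ties may be
broken in any non-anticipating way). -/
structure IsOMG {mΩ : MeasurableSpace Ω} (μ : Measure Ω) (ℱ : Filtration ℕ mΩ)
    (δ p : ℕ → Ω → Fin n → ℝ) (W Γ : Fin n → ℝ) (c : ControlProcess n Ω) : Prop where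
  adapted : c.IsAdapted ℱ
  solves : ∀ t, ∀ᵐ ω ∂μ,
    N.IsOnlineSolution W Γ (N.storage c.u t ω) (δ t ω) (p t ω) (c.decision t ω)

end StorageNetwork

/-!
The balance equation only determines the net generations, so the online program minimizes a
continuous function over a compact set of controls and line flows (the flows form a subspace
intersected with a box) that does not depend on the disturbances.  This gives optimal solutions
(`exists_isOnlineSolution`) and, by restricting the infimum to a countable dense subset, a measurable
optimal value (`exists_measurable_value`).

**Storage levels.**  Changing one control alone keeps a decision feasible.  Hence if the weight
`λᵢ / Wᵢ * (sᵢ + Γᵢ)` exceeds minus every subgradient of the cost, the greedy control is `Umin`, and if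
it lies below minus every subgradient, the greedy control is `Umax`.  The interval for `Γᵢ` is exactly
what makes the storage levels stay within their bounds in the remaining cases
(`IsOnlineSolution.storage_mem`).

**Performance.**  The usual Lyapunov argument compares the greedy policy with an optimal stationary
policy.  Here no stationary policy is constructed: the greedy policy is compared directly with an
arbitrary admissible process `c'`.  For every fixed storage level `s`, the expected optimal value of
the online program is at most the expected objective at `s` of the decision of `c'` in any period `τ`,
since the disturbances of all periods have the same law.  The storage level of the greedy policy in
period `t` is independent of the disturbances of that period, so Fubini's theorem allows `s` to be
replaced by it (`IsOMG.integral_onlineObjective_le`).  Averaged over the periods `τ < T`, the mean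
control of `c'` equals `(1 - λᵢ) * s'` up to `O(1 / T)` for some level `s'` within the bounds
(`Admissible.exists_average_control`).  Inserted into the drift of the quadratic Lyapunov function
`∑ i, (sᵢ + Γᵢ) ^ 2 / (2 * Wᵢ)`, this bounds drift plus cost in each period by the average cost of `c'`
over `T` periods plus `∑ i, M i (Γ i) / W i + O(1 / T)` (`IsOMG.cost_add_drift_le`).  Summing over the
periods of the greedy policy telescopes the drift, and letting `T` tend to infinity gives the bound.
-/

/-! ### Convex functions of one real variable -/

/-- A finite convex function on the real line has a subgradient everywhere: its right derivative
is one. -/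
lemma ConvexOn.exists_subgradient_real {h : ℝ → ℝ} (hh : ConvexOn ℝ univ h) (x : ℝ) :
    ∃ α : ℝ, ∀ y, h x + α * (y - x) ≤ h y := by
  refine ⟨derivWithin h (Ioi x) x, fun y => ?_⟩
  have hx : x ∈ interior (univ : Set ℝ) := by simp
  rcases lt_trichotomy x y with hxy | rfl | hxy
  · have h1 := hh.rightDeriv_le_slope_of_mem_interior hx (mem_univ y) hxy
    rw [slope_def_field, le_div_iff₀ (sub_pos.2 hxy)] at h1
    linarith
  · simp
  · have h1 := hh.slope_le_leftDeriv_of_mem_interior (mem_univ y) hx hxy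
    have h2 := h1.trans (hh.leftDeriv_le_rightDeriv_of_mem_interior hx)
    rw [slope_def_field, div_le_iff₀ (sub_pos.2 hxy)] at h2
    linarith

/-- On a bounded interval a convex function is controlled by its values at three fixed points: the
endpoints bound it from above and, by reflection in the midpoint, also from below. -/
lemma ConvexOn.abs_le_of_mem_Icc {h : ℝ → ℝ} (hh : ConvexOn ℝ univ h) {a b x : ℝ}
    (hx : x ∈ Icc a b) : |h x| ≤ 2 * |h ((a + b) / 2)| + |h a| + |h b| := by
  have upper : ∀ y ∈ Icc a b, h y ≤ |h a| + |h b| := fun y hy =>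
    (hh.le_max_of_mem_Icc (mem_univ a) (mem_univ b) hy).trans
      (max_le (by linarith [le_abs_self (h a), abs_nonneg (h b)])
        (by linarith [le_abs_self (h b), abs_nonneg (h a)]))
  have hx' : a + b - x ∈ Icc a b := ⟨by linarith [hx.2], by linarith [hx.1]⟩
  have hmid := hh.2 (mem_univ x) (mem_univ (a + b - x)) (by norm_num : (0 : ℝ) ≤ 1 / 2)
    (by norm_num : (0 : ℝ) ≤ 1 / 2) (by norm_num)
  have hpt : (1 / 2 : ℝ) • x + (1 / 2 : ℝ) • (a + b - x) = (a + b) / 2 := by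
    simp only [smul_eq_mul]; ring
  rw [hpt] at hmid
  simp only [smul_eq_mul] at hmid
  rw [abs_le]
  constructor
  · linarith [upper _ hx', neg_abs_le (h ((a + b) / 2))]
  · linarith [upper _ hx, abs_nonneg (h ((a + b) / 2))]

namespace StorageNetwork

variable {n : ℕ} (N : StorageNetwork n)

lemma continuous_cost (i : Fin n) {q : ℝ} (hq : q ∈ Icc (N.Pmin i) (N.Pmax i)) :
    Continuous fun r => N.g i r q :=
  continuousOn_univ.1 ((N.g_convex i q hq).continuousOn isOpen_univ)

variable {N}

lemma FeasibleControllable.Umin_le_Umax (hN : N.FeasibleControllable) (i : Fin n) :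
    N.Umin i ≤ N.Umax i := by
  linarith [hN.feas_lower i, hN.contr_lower i]

variable (N)

/-! ### Existence of optimal solutions of the online program -/

/-- The DC power flow: the line flows that result from voltage angles. -/
def dcFlow : (Fin n → ℝ) →ₗ[ℝ] (Fin n → Fin n → ℝ) where
  toFun θ i j := N.B i j * (θ i - θ j)
  map_add' θ θ' := by ext i j; simp only [Pi.add_apply]; ring
  map_smul' a θ := by
    ext i j; simp only [Pi.smul_apply, smul_eq_mul, RingHom.id_apply]; ring

/-- The pairs of storage controls and line flows that extend to a feasible decision.  They do not
depend on the net supplies, because the balance equation only determines the net generations. -/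
def controlFlowSet : Set ((Fin n → ℝ) × (Fin n → Fin n → ℝ)) :=
  {x | (∀ i, x.1 i ∈ Icc (N.Umin i) (N.Umax i)) ∧ x.2 ∈ range N.dcFlow ∧
    ∀ i j, x.2 i j ∈ Icc (-N.Fmax i j) (N.Fmax i j)}

/-- The voltage angles are unbounded, but the flows they generate form a subspace, which is closed
in finite dimension. -/
lemma isCompact_controlFlowSet : IsCompact N.controlFlowSet := by
  have hrange : IsClosed (range N.dcFlow) := by
    have h := (LinearMap.range N.dcFlow).closed_of_finiteDimensional
    rwa [LinearMap.coe_range] at h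
  have hbox : IsCompact (Icc N.Umin N.Umax ×ˢ Icc (fun i j => -N.Fmax i j) N.Fmax) :=
    isCompact_Icc.prod isCompact_Icc
  have heq : N.controlFlowSet =
      (Icc N.Umin N.Umax ×ˢ Icc (fun i j => -N.Fmax i j) N.Fmax) ∩ Prod.snd ⁻¹' range N.dcFlow := by
    ext x
    simp only [controlFlowSet, mem_ofPred_eq, mem_inter_iff, mem_prod, mem_Icc, Pi.le_def,
      mem_preimage]
    constructor
    · rintro ⟨h1, h2, h3⟩
      exact ⟨⟨⟨fun i => (h1 i).1, fun i => (h1 i).2⟩, fun i j => (h3 i j).1,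
        fun i j => (h3 i j).2⟩, h2⟩
    · rintro ⟨⟨⟨h1, h1'⟩, h3, h3'⟩, h2⟩
      exact ⟨fun i => ⟨h1 i, h1' i⟩, h2, fun i j => ⟨h3 i j, h3' i j⟩⟩
  rw [heq]
  exact hbox.inter_right (hrange.preimage continuous_snd)

variable {N} in
lemma FeasibleControllable.nonempty_controlFlowSet (hN : N.FeasibleControllable) :
    N.controlFlowSet.Nonempty :=
  ⟨(N.Umin, 0), fun i => ⟨le_rfl, hN.Umin_le_Umax i⟩, ⟨0, map_zero _⟩, fun i j => by
    simp [N.Fmax_nonneg i j]⟩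

/-- The objective of the online program as a function of the controls and flows alone, the net
generations being eliminated by the balance equation. -/
noncomputable def reducedObjective (W Γ s δ p : Fin n → ℝ)
    (x : (Fin n → ℝ) × (Fin n → Fin n → ℝ)) : ℝ :=
  ∑ i, (N.lam i / W i * (s i + Γ i) * x.1 i + N.g i (x.1 i + ∑ j, x.2 i j - δ i) (p i))

variable {N} {W Γ s δ p : Fin n → ℝ} {d : Decision n}

lemma PeriodFeasible.mem_controlFlowSet (hd : N.PeriodFeasible δ d) :
    (d.u, d.f) ∈ N.controlFlowSet :=
  ⟨hd.control, ⟨d.θ, by ext i j; exact hd.flow i j⟩, hd.capacity⟩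

lemma PeriodFeasible.r_eq (hd : N.PeriodFeasible δ d) (i : Fin n) :
    d.r i = d.u i + ∑ j, d.f i j - δ i := by
  linarith [hd.balance i]

lemma PeriodFeasible.onlineObjective_eq (hd : N.PeriodFeasible δ d) :
    N.onlineObjective W Γ s p d = N.reducedObjective W Γ s δ p (d.u, d.f) := by
  simp only [onlineObjective, reducedObjective, hd.r_eq]

/-- Every pair of controls and flows in `controlFlowSet` extends to a feasible decision. -/
lemma exists_periodFeasible (δ : Fin n → ℝ) {x : (Fin n → ℝ) × (Fin n → Fin n → ℝ)}
    (hx : x ∈ N.controlFlowSet) :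
    ∃ d : Decision n, N.PeriodFeasible δ d ∧ (d.u, d.f) = x := by
  obtain ⟨h1, ⟨θ, hθ⟩, h3⟩ := hx
  refine ⟨⟨x.1, fun i => x.1 i + ∑ j, x.2 i j - δ i, θ, x.2⟩, ⟨fun i => ?_, h1, fun i j => ?_, h3⟩,
    rfl⟩
  · simp
  · exact congrFun (congrFun hθ i) j

lemma continuous_reducedObjective (hp : ∀ i, p i ∈ Icc (N.Pmin i) (N.Pmax i)) :
    Continuous (N.reducedObjective W Γ s δ p) := by
  refine continuous_finsetSum _ fun i _ => Continuous.add (by fun_prop) ?_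
  exact (N.continuous_cost i (hp i)).comp (by fun_prop)

lemma exists_isOnlineSolution (hN : N.FeasibleControllable)
    (hp : ∀ i, p i ∈ Icc (N.Pmin i) (N.Pmax i)) :
    ∃ d, N.IsOnlineSolution W Γ s δ p d := by
  obtain ⟨x, hx, hmin⟩ := N.isCompact_controlFlowSet.exists_isMinOn hN.nonempty_controlFlowSet
    (continuous_reducedObjective (W := W) (Γ := Γ) (s := s) (δ := δ) hp).continuousOn
  obtain ⟨d, hd, rfl⟩ := exists_periodFeasible δ hx
  refine ⟨d, hd, fun d' (hd' : N.PeriodFeasible δ d') => ?_⟩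
  rw [mem_ofPred_eq, hd.onlineObjective_eq, hd'.onlineObjective_eq]
  exact hmin hd'.mem_controlFlowSet

variable (N) in
/-- The optimal value of the online program is a measurable function of the storage levels and the
disturbances: it is the infimum of the objective over a countable dense set of controls and
flows. -/
lemma exists_measurable_value (hN : N.FeasibleControllable) (W Γ : Fin n → ℝ) :
    ∃ V : (Fin n → ℝ) × ((Fin n → ℝ) × (Fin n → ℝ)) → ℝ, Measurable V ∧
      ∀ s δ p d, (∀ i, p i ∈ Icc (N.Pmin i) (N.Pmax i)) → N.IsOnlineSolution W Γ s δ p d →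
        V (s, δ, p) = N.onlineObjective W Γ s p d := by
  have : Nonempty N.controlFlowSet := hN.nonempty_controlFlowSet.to_subtype
  let x : ℕ → N.controlFlowSet := TopologicalSpace.denseSeq _
  refine ⟨fun y => ⨅ k, N.reducedObjective W Γ y.1 y.2.1 y.2.2 (x k), ?_, ?_⟩
  · refine Measurable.iInf fun k => ?_
    refine Finset.measurable_sum _ fun i _ => Measurable.add (by fun_prop) ?_
    exact (N.g_measurable i).comp (f := fun y : (Fin n → ℝ) × ((Fin n → ℝ) × (Fin n → ℝ)) =>
      ((x k).1.1 i + ∑ j, (x k).1.2 i j - y.2.1 i, y.2.2 i)) (by fun_prop)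
  · rintro s δ p d hp ⟨hd, hmin⟩
    have hle : ∀ k, N.onlineObjective W Γ s p d ≤ N.reducedObjective W Γ s δ p (x k) := fun k => by
      obtain ⟨d', hd', hx'⟩ := exists_periodFeasible δ (x k).2
      rw [← hx', ← hd'.onlineObjective_eq]
      exact hmin hd'
    refine le_antisymm ?_ (le_ciInf hle)
    -- the lower bound over the dense sequence persists on the closure
    have hclosed : IsClosed {z : N.controlFlowSet |
        ⨅ k, N.reducedObjective W Γ s δ p (x k) ≤ N.reducedObjective W Γ s δ p z} :=
      isClosed_le continuous_const
        ((continuous_reducedObjective hp).comp continuous_subtype_val)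
    have hall := closure_minimal (s := range x) (by
      rintro _ ⟨k, rfl⟩
      exact ciInf_le ⟨_, by rintro _ ⟨k, rfl⟩; exact hle k⟩ k) hclosed
    rw [(TopologicalSpace.denseRange_denseSeq _).closure_range] at hall
    rw [hd.onlineObjective_eq]
    exact hall (mem_univ ⟨_, hd.mem_controlFlowSet⟩)

/-! ### The greedy decision keeps the storage levels within their bounds -/

/-- Changing the control of a single storage, and adapting the net generation at its bus, keeps a
decision feasible; so an optimal decision is optimal bus by bus. -/
lemma IsOnlineSolution.le_of_control (hd : N.IsOnlineSolution W Γ s δ p d) (i : Fin n) {v : ℝ}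
    (hv : v ∈ Icc (N.Umin i) (N.Umax i)) :
    N.lam i / W i * (s i + Γ i) * d.u i + N.g i (d.u i - δ i + ∑ j, d.f i j) (p i) ≤
      N.lam i / W i * (s i + Γ i) * v + N.g i (v - δ i + ∑ j, d.f i j) (p i) := by
  classical
  obtain ⟨hfeas, hmin⟩ := hd
  let d' : Decision n := ⟨Function.update d.u i v,
    Function.update d.r i (v - δ i + ∑ j, d.f i j), d.θ, d.f⟩
  have hd' : N.PeriodFeasible δ d' := by
    refine ⟨fun k => ?_, fun k => ?_, hfeas.flow, hfeas.capacity⟩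
    · rcases eq_or_ne k i with rfl | hk
      · simp only [d', Function.update_self]; ring
      · simpa only [d', Function.update_of_ne hk] using hfeas.balance k
    · rcases eq_or_ne k i with rfl | hk
      · simpa only [d', Function.update_self] using hv
      · simpa only [d', Function.update_of_ne hk] using hfeas.control k
  have h : N.onlineObjective W Γ s p d ≤ N.onlineObjective W Γ s p d' := hmin hd'
  unfold onlineObjective at h
  rw [← Finset.add_sum_erase _ _ (Finset.mem_univ i),
    ← Finset.add_sum_erase _ _ (Finset.mem_univ i)] at h
  have hrest : ∑ k ∈ Finset.univ.erase i,
        (N.lam k / W k * (s k + Γ k) * d'.u k + N.g k (d'.r k) (p k)) =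
      ∑ k ∈ Finset.univ.erase i, (N.lam k / W k * (s k + Γ k) * d.u k + N.g k (d.r k) (p k)) :=
    Finset.sum_congr rfl fun k hk => by
      simp only [d', Function.update_of_ne (Finset.ne_of_mem_erase hk)]
  rw [hrest] at h
  have h' := le_of_add_le_add_right h
  simp only [d', Function.update_self] at h'
  rwa [show d.r i = d.u i - δ i + ∑ j, d.f i j by linarith [hfeas.balance i]] at h'

lemma PeriodFeasible.exists_mem_subgradients (hd : N.PeriodFeasible δ d) (i : Fin n)
    (hδ : δ i ∈ Icc (N.δmin i) (N.δmax i)) (hp : p i ∈ Icc (N.Pmin i) (N.Pmax i)) {v : ℝ}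
    (hv : v ∈ Icc (N.Umin i) (N.Umax i)) :
    ∃ α ∈ N.subgradients i, ∀ u' : ℝ, N.g i (v - δ i + ∑ j, d.f i j) (p i) + α * (u' - v) ≤
      N.g i (u' - δ i + ∑ j, d.f i j) (p i) := by
  obtain ⟨α, hα⟩ := (N.g_convex i _ hp).exists_subgradient_real (v - δ i + ∑ j, d.f i j)
  have h : ∀ u' : ℝ, N.g i (v - δ i + ∑ j, d.f i j) (p i) + α * (u' - v) ≤
      N.g i (u' - δ i + ∑ j, d.f i j) (p i) := fun u' => by
    have := hα (u' - δ i + ∑ j, d.f i j)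
    rwa [show u' - δ i + ∑ j, d.f i j - (v - δ i + ∑ j, d.f i j) = u' - v by ring] at this
  exact ⟨α, ⟨v, hv, d.f, hd.capacity, δ i, hδ, p i, hp, h⟩, h⟩

/-- If the weight of the control exceeds `-Dlo`, the greedy decision discharges at full rate. -/
lemma IsOnlineSolution.u_eq_Umin (hd : N.IsOnlineSolution W Γ s δ p d) {i : Fin n}
    (hδ : δ i ∈ Icc (N.δmin i) (N.δmax i)) (hp : p i ∈ Icc (N.Pmin i) (N.Pmax i))
    {Dlo : ℝ} (hDlo : Dlo ∈ lowerBounds (N.subgradients i))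
    (h : 0 < N.lam i / W i * (s i + Γ i) + Dlo) : d.u i = N.Umin i := by
  have hu := hd.1.control i
  have hv : N.Umin i ∈ Icc (N.Umin i) (N.Umax i) := ⟨le_rfl, hu.1.trans hu.2⟩
  obtain ⟨α, hα, hsub⟩ := hd.1.exists_mem_subgradients i hδ hp hv
  by_contra hne
  have hlt : 0 < d.u i - N.Umin i := sub_pos.2 (lt_of_le_of_ne hu.1 (Ne.symm hne))
  have h1 := hd.le_of_control i hv
  have h2 := hsub (d.u i)
  have h3 := mul_le_mul_of_nonneg_right (hDlo hα) hlt.le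
  have h4 := mul_pos h hlt
  linarith

/-- If the weight of the control is below `-Dup`, the greedy decision charges at full rate. -/
lemma IsOnlineSolution.u_eq_Umax (hd : N.IsOnlineSolution W Γ s δ p d) {i : Fin n}
    (hδ : δ i ∈ Icc (N.δmin i) (N.δmax i)) (hp : p i ∈ Icc (N.Pmin i) (N.Pmax i))
    {Dup : ℝ} (hDup : Dup ∈ upperBounds (N.subgradients i))
    (h : N.lam i / W i * (s i + Γ i) + Dup < 0) : d.u i = N.Umax i := by
  have hu := hd.1.control i
  have hv : N.Umax i ∈ Icc (N.Umin i) (N.Umax i) := ⟨hu.1.trans hu.2, le_rfl⟩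
  obtain ⟨α, hα, hsub⟩ := hd.1.exists_mem_subgradients i hδ hp hv
  by_contra hne
  have hlt : 0 < N.Umax i - d.u i := sub_pos.2 (lt_of_le_of_ne hu.2 hne)
  have h1 := hd.le_of_control i hv
  have h2 := hsub (d.u i)
  have h3 := mul_le_mul_of_nonneg_right (hDup hα) hlt.le
  have h4 := mul_pos_of_neg_of_neg h (neg_neg_of_pos hlt)
  linarith

/-- One step of the greedy policy keeps the storage level within its bounds.  If the storage charges
at full rate, the lower bound holds by feasibility; otherwise its level is so high that the lower
bound holds for every control.  Discharging and the upper bound are symmetric. -/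
lemma IsOnlineSolution.storage_mem (hN : N.FeasibleControllable)
    (hd : N.IsOnlineSolution W Γ s δ p d) {i : Fin n}
    (hδ : δ i ∈ Icc (N.δmin i) (N.δmax i)) (hp : p i ∈ Icc (N.Pmin i) (N.Pmax i))
    {Dlo Dup : ℝ} (hDlo : Dlo ∈ lowerBounds (N.subgradients i))
    (hDup : Dup ∈ upperBounds (N.subgradients i)) (hW : 0 < W i)
    (hΓmin : N.Γmin i Dlo (W i) ≤ Γ i) (hΓmax : Γ i ≤ N.Γmax i Dup (W i))
    (hs : s i ∈ Icc (N.Smin i) (N.Smax i)) :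
    N.lam i * s i + d.u i ∈ Icc (N.Smin i) (N.Smax i) := by
  have hl := N.lam_pos i
  have hu := hd.1.control i
  rw [Γmin, one_div_mul_eq_div, div_le_iff₀ hl] at hΓmin
  rw [Γmax, one_div_mul_eq_div, le_div_iff₀ hl] at hΓmax
  have hsmin := mul_le_mul_of_nonneg_left hs.1 hl.le
  have hsmax := mul_le_mul_of_nonneg_left hs.2 hl.le
  have hcancel : W i * (N.lam i / W i * (s i + Γ i)) = N.lam i * s i + Γ i * N.lam i := by
    field_simp
  have weight : ∀ D : ℝ, W i * (N.lam i / W i * (s i + Γ i) + D) =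
      N.lam i * s i + Γ i * N.lam i + W i * D := fun D => by rw [mul_add, hcancel]
  constructor
  · by_cases h : N.lam i / W i * (s i + Γ i) + Dup < 0
    · rw [hd.u_eq_Umax hδ hp hDup h]
      linarith [hN.feas_lower i]
    · have := mul_nonneg hW.le (not_lt.1 h)
      rw [weight] at this
      linarith [hu.1]
  · by_cases h : 0 < N.lam i / W i * (s i + Γ i) + Dlo
    · rw [hd.u_eq_Umin hδ hp hDlo h]
      linarith [hN.feas_upper i]
    · have := mul_nonpos_of_nonneg_of_nonpos hW.le (not_lt.1 h)
      rw [weight] at this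
      linarith [hu.2]

end StorageNetwork

/-! ### Independence and integrals -/

/-- If `X` is independent of `S`, an upper bound `φ s` for the mean of `V (s, X)` that holds for
every fixed `s` may be averaged over `S`.  The bound is only needed where `V (s, X)` is integrable,
which by Fubini's theorem is the case for almost every value of `S`. -/
lemma ProbabilityTheory.IndepFun.integral_comp_prodMk_le {Ω α β : Type*} {mΩ : MeasurableSpace Ω}
    [MeasurableSpace α] [MeasurableSpace β] {μ : Measure Ω} [IsProbabilityMeasure μ]
    {S : Ω → α} {X : Ω → β} (hS : Measurable S) (hX : Measurable X) (hSX : IndepFun S X μ)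
    {V : α × β → ℝ} (hV : Measurable V) (hVint : Integrable (fun ω => V (S ω, X ω)) μ)
    {φ : α → ℝ} (hφ : Measurable φ) (hφint : Integrable (fun ω => φ (S ω)) μ)
    (h : ∀ s, Integrable (fun x => V (s, x)) (μ.map X) → ∫ x, V (s, x) ∂(μ.map X) ≤ φ s) :
    ∫ ω, V (S ω, X ω) ∂μ ≤ ∫ ω, φ (S ω) ∂μ := by
  have : IsProbabilityMeasure (μ.map S) := Measure.isProbabilityMeasure_map hS.aemeasurable
  have : IsProbabilityMeasure (μ.map X) := Measure.isProbabilityMeasure_map hX.aemeasurable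
  have hmap : μ.map (fun ω => (S ω, X ω)) = (μ.map S).prod (μ.map X) :=
    (indepFun_iff_map_prod_eq_prod_map_map hS.aemeasurable hX.aemeasurable).1 hSX
  have hprod : Integrable V ((μ.map S).prod (μ.map X)) := by
    rw [← hmap, integrable_map_measure hV.aestronglyMeasurable (hS.prodMk hX).aemeasurable]
    exact hVint
  have hφmap : Integrable φ (μ.map S) := by
    rw [integrable_map_measure hφ.aestronglyMeasurable hS.aemeasurable]
    exact hφint
  calc ∫ ω, V (S ω, X ω) ∂μ = ∫ y, V y ∂(μ.map (fun ω => (S ω, X ω))) :=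
        (integral_map (hS.prodMk hX).aemeasurable hV.aestronglyMeasurable).symm
    _ = ∫ s, ∫ x, V (s, x) ∂(μ.map X) ∂(μ.map S) := by rw [hmap, integral_prod _ hprod]
    _ ≤ ∫ s, φ s ∂(μ.map S) := by
        refine integral_mono_ae hprod.integral_prod_left hφmap ?_
        filter_upwards [hprod.prod_right_ae] with s hs using h s hs
    _ = ∫ ω, φ (S ω) ∂μ := integral_map hS.aemeasurable hφ.aestronglyMeasurable

namespace StorageNetwork

variable {n : ℕ} {N : StorageNetwork n} {Ω : Type*}

/-! ### Measurability and integrability along a control process -/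

lemma measurable_storage {m : MeasurableSpace Ω} {u : ℕ → Ω → Fin n → ℝ} {t : ℕ}
    (hu : ∀ k < t, Measurable (u k)) : Measurable (N.storage u t) := by
  induction t with
  | zero => exact measurable_const
  | succ t ih =>
    have h1 := ih fun k hk => hu k (hk.trans t.lt_succ_self)
    have h2 := hu t t.lt_succ_self
    refine measurable_pi_iff.2 fun i => ?_
    exact ((measurable_pi_iff.1 h1 i).const_mul _).add (measurable_pi_iff.1 h2 i)

variable {mΩ : MeasurableSpace Ω} {μ : Measure Ω} {ℱ : Filtration ℕ mΩ}
  {δ p : ℕ → Ω → Fin n → ℝ} {W Γ : Fin n → ℝ} {c c' : ControlProcess n Ω}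

lemma measurable_storage_of_isAdapted (hc : c.IsAdapted ℱ) (t : ℕ) :
    Measurable (N.storage c.u t) :=
  measurable_storage fun k _ => (hc.u k).mono (ℱ.le k) le_rfl

/-- The storage level at the beginning of a period depends on the information of the preceding
periods only, so it is independent of the disturbances of that period. -/
lemma indepFun_storage [IsProbabilityMeasure μ]
    (hiid : N.IIDDisturbances μ ℱ δ p) (hc : c.IsAdapted ℱ) (t : ℕ) :
    IndepFun (N.storage c.u t) (fun ω => (δ t ω, p t ω)) μ := by
  cases t with
  | zero => exact indepFun_const_left _ _
  | succ t =>
    refine (IndepFun_iff_Indep _ _ _).2 (indep_of_indep_of_le_left (hiid.indep t) ?_)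
    have : Measurable[ℱ t] (N.storage c.u (t + 1)) :=
      measurable_storage fun k hk => (hc.u k).mono (ℱ.mono (Nat.lt_succ_iff.1 hk)) le_rfl
    exact this.comap_le

lemma IIDDisturbances.measurable (hiid : N.IIDDisturbances μ ℱ δ p) (t : ℕ) :
    Measurable fun ω => (δ t ω, p t ω) :=
  ((hiid.δ_adapted t).mono (ℱ.le t) le_rfl).prodMk ((hiid.p_adapted t).mono (ℱ.le t) le_rfl)

lemma IIDDisturbances.integrable_cost_const (hiid : N.IIDDisturbances μ ℱ δ p)
    (hint : ∀ i r, Integrable (fun ω => N.g i r (p 0 ω i)) μ) (t : ℕ) (i : Fin n) (r : ℝ) :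
    Integrable (fun ω => N.g i r (p t ω i)) μ := by
  have hg : Measurable fun x : (Fin n → ℝ) × (Fin n → ℝ) => N.g i r (x.2 i) :=
    (N.g_measurable i).comp (f := fun x : (Fin n → ℝ) × (Fin n → ℝ) => (r, x.2 i)) (by fun_prop)
  exact ((hiid.identDistrib t).comp hg).integrable_iff.2 (hint i r)

/-- The net generation in a period is bounded, so its cost is dominated by the costs of three fixed
net generations. -/
lemma integrable_cost (hiid : N.IIDDisturbances μ ℱ δ p)
    (hint : ∀ i r, Integrable (fun ω => N.g i r (p 0 ω i)) μ) (hc : c.IsAdapted ℱ) {t : ℕ}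
    (hfeas : ∀ᵐ ω ∂μ, N.PeriodFeasible (δ t ω) (c.decision t ω)) (i : Fin n) :
    Integrable (fun ω => N.g i (c.r t ω i) (p t ω i)) μ := by
  have hI := hiid.integrable_cost_const hint t i
  set a := N.Umin i + ∑ j, -N.Fmax i j - N.δmax i
  set b := N.Umax i + ∑ j, N.Fmax i j - N.δmin i
  have hr : Measurable fun ω => c.r t ω i :=
    (measurable_pi_apply i).comp ((hc.r t).mono (ℱ.le t) le_rfl)
  have hp : Measurable fun ω => p t ω i :=
    (measurable_pi_apply i).comp ((hiid.p_adapted t).mono (ℱ.le t) le_rfl)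
  refine Integrable.mono'
    ((((hI ((a + b) / 2)).abs.const_mul 2).add (hI a).abs).add (hI b).abs)
    ((N.g_measurable i).comp (hr.prodMk hp)).aestronglyMeasurable ?_
  filter_upwards [hfeas, hiid.δ_mem t, hiid.p_mem t] with ω hω hδ hpω
  refine (N.g_convex i _ (hpω i)).abs_le_of_mem_Icc (a := a) (b := b) ?_
  have hreq : c.r t ω i = c.u t ω i + ∑ j, c.f t ω i j - δ t ω i := hω.r_eq i
  have hu : c.u t ω i ∈ Icc (N.Umin i) (N.Umax i) := hω.control i
  have h1 : ∑ j, -N.Fmax i j ≤ ∑ j, c.f t ω i j :=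
    Finset.sum_le_sum fun j _ => (hω.capacity i j).1
  have h2 : ∑ j, c.f t ω i j ≤ ∑ j, N.Fmax i j :=
    Finset.sum_le_sum fun j _ => (hω.capacity i j).2
  rw [hreq]
  exact ⟨by linarith [hu.1, (hδ i).2], by linarith [hu.2, (hδ i).1]⟩

lemma Admissible.ae_control_mem (hc : N.Admissible μ ℱ δ c) (t : ℕ) (i : Fin n) :
    ∀ᵐ ω ∂μ, c.u t ω i ∈ Icc (N.Umin i) (N.Umax i) := by
  filter_upwards [hc.feasible t] with ω hω using hω.control i

lemma Admissible.measurable_control (hc : N.Admissible μ ℱ δ c) (t : ℕ) (i : Fin n) :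
    Measurable fun ω => c.u t ω i :=
  (measurable_pi_apply i).comp ((hc.adapted.u t).mono (ℱ.le t) le_rfl)

lemma Admissible.integrable_control [IsProbabilityMeasure μ]
    (hc : N.Admissible μ ℱ δ c) (t : ℕ) (i : Fin n) :
    Integrable (fun ω => c.u t ω i) μ :=
  Integrable.of_mem_Icc _ _ (hc.measurable_control t i).aemeasurable (hc.ae_control_mem t i)

lemma Admissible.ae_storage_mem (hc : N.Admissible μ ℱ δ c) (t : ℕ) (i : Fin n) :
    ∀ᵐ ω ∂μ, N.storage c.u t ω i ∈ Icc (N.Smin i) (N.Smax i) := by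
  filter_upwards [hc.storage_mem t] with ω hω using hω i

lemma Admissible.measurable_storage_apply (hc : N.Admissible μ ℱ δ c) (t : ℕ) (i : Fin n) :
    Measurable fun ω => N.storage c.u t ω i :=
  (measurable_pi_apply i).comp (measurable_storage_of_isAdapted hc.adapted t)

lemma Admissible.integrable_storage [IsProbabilityMeasure μ]
    (hc : N.Admissible μ ℱ δ c) (t : ℕ) (i : Fin n) :
    Integrable (fun ω => N.storage c.u t ω i) μ :=
  Integrable.of_mem_Icc _ _ (hc.measurable_storage_apply t i).aemeasurable (hc.ae_storage_mem t i)

lemma Admissible.integral_storage_mem [IsProbabilityMeasure μ]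
    (hc : N.Admissible μ ℱ δ c) (t : ℕ) (i : Fin n) :
    ∫ ω, N.storage c.u t ω i ∂μ ∈ Icc (N.Smin i) (N.Smax i) :=
  (convex_Icc _ _).integral_mem isClosed_Icc (hc.ae_storage_mem t i) (hc.integrable_storage t i)

lemma Admissible.integral_storage_succ [IsProbabilityMeasure μ]
    (hc : N.Admissible μ ℱ δ c) (t : ℕ) (i : Fin n) :
    ∫ ω, N.storage c.u (t + 1) ω i ∂μ =
      N.lam i * ∫ ω, N.storage c.u t ω i ∂μ + ∫ ω, c.u t ω i ∂μ := by
  rw [← integral_const_mul,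
    ← integral_add ((hc.integrable_storage t i).const_mul _) (hc.integrable_control t i)]
  rfl

lemma Admissible.integrable_storage_mul_control [IsProbabilityMeasure μ]
    (hc : N.Admissible μ ℱ δ c) (t : ℕ) (i : Fin n) :
    Integrable (fun ω => (N.storage c.u t ω i + Γ i) * c.u t ω i) μ := by
  refine Integrable.bdd_mul (c := |N.Smin i + Γ i| + |N.Smax i + Γ i|)
    (hc.integrable_control t i)
    ((hc.measurable_storage_apply t i).add_const _).aestronglyMeasurable ?_
  filter_upwards [hc.ae_storage_mem t i] with ω hω
  rw [Real.norm_eq_abs]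
  exact (abs_le_max_abs_abs (add_le_add_left hω.1 _) (add_le_add_left hω.2 _)).trans
    (max_le_add_of_nonneg (abs_nonneg _) (abs_nonneg _))

lemma Admissible.integrable_storage_weight [IsProbabilityMeasure μ]
    (hc : N.Admissible μ ℱ δ c) (t : ℕ) (i : Fin n) :
    Integrable (fun ω => N.lam i / W i * (N.storage c.u t ω i + Γ i) * c.u t ω i) μ := by
  simpa only [mul_assoc] using (hc.integrable_storage_mul_control (Γ := Γ) t i).const_mul
    (N.lam i / W i)

/-! ### The greedy policy is admissible -/

/-- The storage levels under the greedy policy stay within their bounds, by induction over the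
periods. -/
lemma IsOMG.ae_storage_mem (hN : N.FeasibleControllable) (hiid : N.IIDDisturbances μ ℱ δ p)
    {Dlo Dup : Fin n → ℝ} (hDlo : ∀ i, Dlo i ∈ lowerBounds (N.subgradients i))
    (hDup : ∀ i, Dup i ∈ upperBounds (N.subgradients i)) (hW : ∀ i, 0 < W i)
    (hΓmin : ∀ i, N.Γmin i (Dlo i) (W i) ≤ Γ i) (hΓmax : ∀ i, Γ i ≤ N.Γmax i (Dup i) (W i))
    (hc : N.IsOMG μ ℱ δ p W Γ c) :
    ∀ᵐ ω ∂μ, ∀ t i, N.storage c.u t ω i ∈ Icc (N.Smin i) (N.Smax i) := by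
  filter_upwards [ae_all_iff.2 hc.solves, ae_all_iff.2 hiid.δ_mem, ae_all_iff.2 hiid.p_mem]
    with ω hsol hδ hp t
  induction t with
  | zero => exact N.sInit_mem
  | succ t ih =>
    exact fun i => (hsol t).storage_mem hN (hδ t i) (hp t i) (hDlo i) (hDup i) (hW i)
      (hΓmin i) (hΓmax i) (ih i)

/-! ### Comparison with an arbitrary admissible process -/

/-- In every period `t`, the expected objective of the online program under the greedy policy is at
most what the mean control and mean cost of any admissible process in any period `τ` give.  The
disturbances of period `t` are independent of the storage level there and distributed as those of
period `τ`, so for every fixed storage level the decision of period `τ` competes with the optimal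
value of the program. -/
lemma IsOMG.integral_onlineObjective_le [IsProbabilityMeasure μ]
    (hN : N.FeasibleControllable)
    (hiid : N.IIDDisturbances μ ℱ δ p)
    (hint : ∀ i r, Integrable (fun ω => N.g i r (p 0 ω i)) μ) (hc : N.IsOMG μ ℱ δ p W Γ c)
    (hadm : N.Admissible μ ℱ δ c) (hc' : N.Admissible μ ℱ δ c') (t τ : ℕ) :
    ∫ ω, N.onlineObjective W Γ (N.storage c.u t ω) (p t ω) (c.decision t ω) ∂μ ≤
      ∑ i, (N.lam i / W i * (∫ ω, N.storage c.u t ω i ∂μ + Γ i) * ∫ ω, c'.u τ ω i ∂μ +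
        ∫ ω, N.g i (c'.r τ ω i) (p τ ω i) ∂μ) := by
  obtain ⟨V, hVmeas, hV⟩ := N.exists_measurable_value hN W Γ
  have hVeq : (fun ω => V (N.storage c.u t ω, δ t ω, p t ω)) =ᵐ[μ]
      fun ω => N.onlineObjective W Γ (N.storage c.u t ω) (p t ω) (c.decision t ω) := by
    filter_upwards [hc.solves t, hiid.p_mem t] with ω hω hp using hV _ _ _ _ hp hω
  have hobj : Integrable
      (fun ω => N.onlineObjective W Γ (N.storage c.u t ω) (p t ω) (c.decision t ω)) μ := by
    refine integrable_finsetSum _ fun i _ => Integrable.add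
      (hadm.integrable_storage_weight t i)
      (integrable_cost hiid hint hadm.adapted (hadm.feasible t) i)
  set φ : (Fin n → ℝ) → ℝ := fun s =>
    ∑ i, (N.lam i / W i * (s i + Γ i) * ∫ ω, c'.u τ ω i ∂μ +
      ∫ ω, N.g i (c'.r τ ω i) (p τ ω i) ∂μ)
  have hφi : ∀ i, Integrable (fun ω => N.lam i / W i * (N.storage c.u t ω i + Γ i) *
      ∫ ω, c'.u τ ω i ∂μ) μ := fun i =>
    (((hadm.integrable_storage t i).add (integrable_const _)).const_mul _).mul_const _
  have hφint : Integrable (fun ω => φ (N.storage c.u t ω)) μ :=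
    integrable_finsetSum _ fun i _ => (hφi i).add (integrable_const _)
  have hcost := integrable_cost hiid hint hc'.adapted (hc'.feasible τ)
  have key := (indepFun_storage hiid hc.adapted t).integral_comp_prodMk_le
    (measurable_storage_of_isAdapted hc.adapted t) (hiid.measurable t) hVmeas
    (hobj.congr hVeq.symm) (φ := φ) (by fun_prop) hφint ?_
  · rw [integral_congr_ae hVeq] at key
    refine key.trans_eq ?_
    refine (integral_finsetSum _ fun i _ => (hφi i).add (integrable_const _)).trans
      (Finset.sum_congr rfl fun i _ => ?_)
    simp only [Pi.add_apply]
    rw [integral_add (hφi i) (integrable_const _), integral_mul_const, integral_const_mul,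
      integral_add (hadm.integrable_storage t i) (integrable_const _)]
    simp
  · intro s hs
    have hVs : Measurable fun x => V (s, x) := hVmeas.comp measurable_prodMk_left
    rw [(hiid.identDistrib t).map_eq, ← (hiid.identDistrib τ).map_eq] at hs ⊢
    rw [integrable_map_measure hVs.aestronglyMeasurable (hiid.measurable τ).aemeasurable] at hs
    rw [integral_map (hiid.measurable τ).aemeasurable hVs.aestronglyMeasurable]
    have hlin : ∀ i, Integrable (fun ω => N.lam i / W i * (s i + Γ i) * c'.u τ ω i) μ := fun i =>
      (hc'.integrable_control τ i).const_mul _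
    calc ∫ ω, V (s, δ τ ω, p τ ω) ∂μ
        ≤ ∫ ω, N.onlineObjective W Γ s (p τ ω) (c'.decision τ ω) ∂μ := by
          refine integral_mono_ae hs
            (integrable_finsetSum _ fun i _ => (hlin i).add (hcost i)) ?_
          filter_upwards [hc'.feasible τ, hiid.p_mem τ] with ω hω hp
          obtain ⟨d, hd⟩ := exists_isOnlineSolution (W := W) (Γ := Γ) (s := s) (δ := δ τ ω) hN hp
          rw [hV _ _ _ _ hp hd]
          exact hd.2 hω
      _ = φ s := by
          refine (integral_finsetSum _ fun i _ => (hlin i).add (hcost i)).trans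
            (Finset.sum_congr rfl fun i _ => ?_)
          rw [← integral_const_mul]
          exact integral_add (hlin i) (hcost i)

/-! ### Lyapunov drift -/

lemma sq_le_max_sq_of_mem_Icc {a b x : ℝ} (hx : x ∈ Icc a b) : x ^ 2 ≤ max (a ^ 2) (b ^ 2) :=
  (even_two.convexOn_pow (𝕜 := ℝ)).le_max_of_mem_Icc (mem_univ a) (mem_univ b) hx

lemma sq_add_le_Ms {i : Fin n} {s : ℝ} (γ : ℝ) (hs : s ∈ Icc (N.Smin i) (N.Smax i)) :
    (s + γ) ^ 2 ≤ N.Ms i γ :=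
  sq_le_max_sq_of_mem_Icc ⟨add_le_add_left hs.1 γ, add_le_add_left hs.2 γ⟩

/-- The drift of the quadratic Lyapunov function in one period. -/
lemma sq_drift_le {i : Fin n} {u : ℝ} (s γ : ℝ) (hu : u ∈ Icc (N.Umin i) (N.Umax i)) :
    (N.lam i * s + u + γ) ^ 2 / 2 - (s + γ) ^ 2 / 2 ≤
      N.Mu i γ + N.lam i * ((s + γ) * u) + N.lam i * (1 - N.lam i) * γ * (s + γ) := by
  have hMu : (u + (1 - N.lam i) * γ) ^ 2 / 2 ≤ N.Mu i γ := by
    have := sq_le_max_sq_of_mem_Icc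
      ⟨add_le_add_left hu.1 ((1 - N.lam i) * γ), add_le_add_left hu.2 ((1 - N.lam i) * γ)⟩
    rw [Mu]
    linarith
  have hcontr : 0 ≤ (1 - N.lam i) * (1 + N.lam i) * (s + γ) ^ 2 :=
    mul_nonneg (mul_nonneg (sub_nonneg.2 (N.lam_le_one i)) (by linarith [N.lam_pos i]))
      (sq_nonneg _)
  linarith [show (N.lam i * s + u + γ) ^ 2 / 2 - (s + γ) ^ 2 / 2 =
    (u + (1 - N.lam i) * γ) ^ 2 / 2 + N.lam i * ((s + γ) * u) +
      N.lam i * (1 - N.lam i) * γ * (s + γ) -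
      (1 - N.lam i) * (1 + N.lam i) * (s + γ) ^ 2 / 2 by ring]

lemma Admissible.integrable_sq_storage [IsProbabilityMeasure μ] (hc : N.Admissible μ ℱ δ c)
    (γ : ℝ) (t : ℕ) (i : Fin n) :
    Integrable (fun ω => (N.storage c.u t ω i + γ) ^ 2 / 2) μ := by
  refine Integrable.div_const (Integrable.of_mem_Icc 0 (N.Ms i γ)
    (((hc.measurable_storage_apply t i).add_const _).pow_const 2).aemeasurable ?_) 2
  filter_upwards [hc.ae_storage_mem t i] with ω hω using ⟨sq_nonneg _, sq_add_le_Ms γ hω⟩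

lemma Admissible.integral_sq_drift_le [IsProbabilityMeasure μ] (hc : N.Admissible μ ℱ δ c)
    (γ : Fin n → ℝ) (t : ℕ) (i : Fin n) :
    ∫ ω, (N.storage c.u (t + 1) ω i + γ i) ^ 2 / 2 ∂μ -
        ∫ ω, (N.storage c.u t ω i + γ i) ^ 2 / 2 ∂μ ≤
      N.Mu i (γ i) + N.lam i * ∫ ω, (N.storage c.u t ω i + γ i) * c.u t ω i ∂μ +
        N.lam i * (1 - N.lam i) * γ i * (∫ ω, N.storage c.u t ω i ∂μ + γ i) := by
  have h1 := (hc.integrable_storage_mul_control (Γ := γ) t i).const_mul (N.lam i)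
  have h2 : Integrable (fun ω => N.storage c.u t ω i + γ i) μ :=
    (hc.integrable_storage t i).add (integrable_const _)
  have h3 := h2.const_mul (N.lam i * (1 - N.lam i) * γ i)
  have h4 : Integrable (fun ω => N.Mu i (γ i) +
      N.lam i * ((N.storage c.u t ω i + γ i) * c.u t ω i)) μ := (integrable_const _).add h1
  calc _ = ∫ ω, ((N.storage c.u (t + 1) ω i + γ i) ^ 2 / 2 -
        (N.storage c.u t ω i + γ i) ^ 2 / 2) ∂μ :=
        (integral_sub (hc.integrable_sq_storage _ _ i) (hc.integrable_sq_storage _ _ i)).symm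
    _ ≤ ∫ ω, (N.Mu i (γ i) + N.lam i * ((N.storage c.u t ω i + γ i) * c.u t ω i) +
        N.lam i * (1 - N.lam i) * γ i * (N.storage c.u t ω i + γ i)) ∂μ := by
        refine integral_mono_ae ((hc.integrable_sq_storage _ _ i).sub
          (hc.integrable_sq_storage _ _ i)) (h4.add h3) ?_
        filter_upwards [hc.ae_control_mem t i] with ω hω using sq_drift_le _ _ hω
    _ = _ := by
        rw [integral_add h4 h3, integral_add (integrable_const _) h1, integral_const_mul,
          integral_const_mul, integral_add (hc.integrable_storage t i) (integrable_const _)]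
        simp

/-! ### Time averages of an admissible process -/

lemma Admissible.averageCost_eq (hiid : N.IIDDisturbances μ ℱ δ p)
    (hint : ∀ i r, Integrable (fun ω => N.g i r (p 0 ω i)) μ) (hc : N.Admissible μ ℱ δ c)
    (T : ℕ) : N.averageCost μ p c T =
      (1 / (T : ℝ)) * ∑ t ∈ Finset.range T, ∑ i, ∫ ω, N.g i (c.r t ω i) (p t ω i) ∂μ := by
  have h := fun t => integrable_cost hiid hint hc.adapted (hc.feasible t)
  rw [averageCost, integral_finsetSum _ fun t _ => integrable_finsetSum _ fun i _ => h t i]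
  congr 1
  exact Finset.sum_congr rfl fun t _ => integral_finsetSum _ fun i _ => h t i

/-- The mean controls add up to the change of the mean storage level and the mean losses. -/
lemma Admissible.sum_integral_control [IsProbabilityMeasure μ] (hc : N.Admissible μ ℱ δ c)
    (T : ℕ) (i : Fin n) :
    ∑ t ∈ Finset.range T, ∫ ω, c.u t ω i ∂μ =
      (∫ ω, N.storage c.u T ω i ∂μ - ∫ ω, N.storage c.u 0 ω i ∂μ) +
        (1 - N.lam i) * ∑ t ∈ Finset.range T, ∫ ω, N.storage c.u t ω i ∂μ := by
  rw [← Finset.sum_range_sub (fun t => ∫ ω, N.storage c.u t ω i ∂μ), Finset.mul_sum,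
    ← Finset.sum_add_distrib]
  refine Finset.sum_congr rfl fun t _ => ?_
  rw [hc.integral_storage_succ]
  ring

/-- Over `T` periods, an admissible process uses on average the control that compensates the losses
at an average level within the bounds, up to an error of order `1 / T`. -/
lemma Admissible.exists_average_control [IsProbabilityMeasure μ] (hc : N.Admissible μ ℱ δ c)
    {T : ℕ} (hT : 0 < T) (i : Fin n) :
    ∃ s ∈ Icc (N.Smin i) (N.Smax i),
      |(1 / (T : ℝ)) * ∑ t ∈ Finset.range T, ∫ ω, c.u t ω i ∂μ - (1 - N.lam i) * s| ≤
        (N.Smax i - N.Smin i) / T := by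
  have hT' : (0 : ℝ) < T := Nat.cast_pos.2 hT
  have hm := fun t => hc.integral_storage_mem t i
  refine ⟨(1 / (T : ℝ)) * ∑ t ∈ Finset.range T, ∫ ω, N.storage c.u t ω i ∂μ, ⟨?_, ?_⟩, ?_⟩
  · rw [one_div_mul_eq_div, le_div_iff₀ hT']
    simpa [mul_comm] using Finset.card_nsmul_le_sum (Finset.range T) _ _ fun t _ => (hm t).1
  · rw [one_div_mul_eq_div, div_le_iff₀ hT']
    simpa [mul_comm] using Finset.sum_le_card_nsmul (Finset.range T) _ _ fun t _ => (hm t).2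
  · rw [hc.sum_integral_control, show ∀ a b l x : ℝ, x * (a + l * b) - l * (x * b) = a * x from
      fun a b l x => by ring, mul_one_div, abs_div, abs_of_pos hT']
    refine div_le_div_of_nonneg_right ?_ hT'.le
    rw [abs_le]
    constructor <;> linarith [(hm T).1, (hm T).2, (hm 0).1, (hm 0).2]

/-! ### The performance bound -/

/-- The elementary inequality that turns the comparison with an average control `v` of the
competitor, which nearly compensates the losses at a level `s'`, into the constant `M`. -/
lemma Mu_add_le {i : Fin n} {γ s s' v e : ℝ} (hs : s ∈ Icc (N.Smin i) (N.Smax i))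
    (hs' : s' ∈ Icc (N.Smin i) (N.Smax i)) (hv : |v - (1 - N.lam i) * s'| ≤ e) :
    N.Mu i γ + N.lam i * ((s + γ) * v) + N.lam i * (1 - N.lam i) * γ * (s + γ) ≤
      N.M i γ + (|N.Smin i + γ| + |N.Smax i + γ|) * e := by
  set R := |N.Smin i + γ| + |N.Smax i + γ|
  have hl0 := (N.lam_pos i).le
  have hl1 := N.lam_le_one i
  have hR : |s + γ| ≤ R :=
    (abs_le_max_abs_abs (add_le_add_left hs.1 _) (add_le_add_left hs.2 _)).trans
      (max_le_add_of_nonneg (abs_nonneg _) (abs_nonneg _))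
  have hmul : (s + γ) * (s' + γ) ≤ N.Ms i γ := by
    have := two_mul_le_add_sq (s + γ) (s' + γ)
    linarith [sq_add_le_Ms γ hs, sq_add_le_Ms γ hs']
  have h1 := mul_le_mul_of_nonneg_left hmul (mul_nonneg hl0 (sub_nonneg.2 hl1))
  have h2 : (s + γ) * (v - (1 - N.lam i) * s') ≤ R * e :=
    (le_abs_self _).trans ((abs_mul _ _).trans_le
      (mul_le_mul hR hv (abs_nonneg _) ((abs_nonneg _).trans hR)))
  have hRe : 0 ≤ R * e := mul_nonneg ((abs_nonneg _).trans hR) ((abs_nonneg _).trans hv)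
  have h3 : N.lam i * ((s + γ) * (v - (1 - N.lam i) * s')) ≤ R * e :=
    (mul_le_mul_of_nonneg_left h2 hl0).trans (mul_le_of_le_one_left hRe hl1)
  rw [M]
  linarith [show N.lam i * ((s + γ) * v) + N.lam i * (1 - N.lam i) * γ * (s + γ) =
    N.lam i * (1 - N.lam i) * ((s + γ) * (s' + γ)) +
      N.lam i * ((s + γ) * (v - (1 - N.lam i) * s')) by ring]

/-- The comparison of `IsOMG.integral_onlineObjective_le`, averaged over the first `T` periods of
the competitor. -/
lemma IsOMG.integral_onlineObjective_le_average [IsProbabilityMeasure μ]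
    (hN : N.FeasibleControllable) (hiid : N.IIDDisturbances μ ℱ δ p)
    (hint : ∀ i r, Integrable (fun ω => N.g i r (p 0 ω i)) μ) (hc : N.IsOMG μ ℱ δ p W Γ c)
    (hadm : N.Admissible μ ℱ δ c) (hc' : N.Admissible μ ℱ δ c') (t : ℕ) {T : ℕ} (hT : 0 < T) :
    ∫ ω, N.onlineObjective W Γ (N.storage c.u t ω) (p t ω) (c.decision t ω) ∂μ ≤
      ∑ i, N.lam i / W i * (∫ ω, N.storage c.u t ω i ∂μ + Γ i) *
        ((1 / (T : ℝ)) * ∑ τ ∈ Finset.range T, ∫ ω, c'.u τ ω i ∂μ) + N.averageCost μ p c' T := by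
  have hT' : (0 : ℝ) < T := Nat.cast_pos.2 hT
  have h := Finset.card_nsmul_le_sum (Finset.range T) _ _ fun τ _ =>
    hc.integral_onlineObjective_le hN hiid hint hadm hc' t τ
  rw [Finset.card_range, nsmul_eq_mul, mul_comm, ← le_div_iff₀ hT'] at h
  refine h.trans_eq ?_
  simp only [Finset.sum_add_distrib]
  rw [hc'.averageCost_eq hiid hint, add_div, one_div_mul_eq_div, Finset.sum_comm]
  congr 1
  rw [Finset.sum_div]
  refine Finset.sum_congr rfl fun i _ => ?_
  rw [← Finset.mul_sum]
  ring

/-- Drift plus cost of the greedy policy in one period, compared with the average cost of an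
admissible process over `T` periods. -/
lemma IsOMG.cost_add_drift_le [IsProbabilityMeasure μ]
    (hN : N.FeasibleControllable) (hiid : N.IIDDisturbances μ ℱ δ p)
    (hint : ∀ i r, Integrable (fun ω => N.g i r (p 0 ω i)) μ) (hW : ∀ i, 0 < W i)
    (hc : N.IsOMG μ ℱ δ p W Γ c) (hadm : N.Admissible μ ℱ δ c) (hc' : N.Admissible μ ℱ δ c')
    (t : ℕ) {T : ℕ} (hT : 0 < T) :
    ∑ i, ∫ ω, N.g i (c.r t ω i) (p t ω i) ∂μ +
        (∑ i, (∫ ω, (N.storage c.u (t + 1) ω i + Γ i) ^ 2 / 2 ∂μ) / W i -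
          ∑ i, (∫ ω, (N.storage c.u t ω i + Γ i) ^ 2 / 2 ∂μ) / W i) ≤
      ∑ i, N.M i (Γ i) / W i + N.averageCost μ p c' T +
        (∑ i, (|N.Smin i + Γ i| + |N.Smax i + Γ i|) * (N.Smax i - N.Smin i) / W i) / T := by
  have hobj : ∫ ω, N.onlineObjective W Γ (N.storage c.u t ω) (p t ω) (c.decision t ω) ∂μ =
      ∑ i, N.lam i / W i * ∫ ω, (N.storage c.u t ω i + Γ i) * c.u t ω i ∂μ +
        ∑ i, ∫ ω, N.g i (c.r t ω i) (p t ω i) ∂μ := by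
    have hcost := integrable_cost hiid hint hadm.adapted (hadm.feasible t)
    have hw := fun i => hadm.integrable_storage_weight (W := W) (Γ := Γ) t i
    rw [← Finset.sum_add_distrib]
    refine (integral_finsetSum _ fun i _ => (hw i).add (hcost i)).trans
      (Finset.sum_congr rfl fun i _ => ?_)
    refine (integral_add (hw i) (hcost i)).trans ?_
    rw [← integral_const_mul]
    simp only [mul_assoc]
  have hle := hc.integral_onlineObjective_le_average hN hiid hint hadm hc' t hT
  rw [hobj] at hle
  have hbus : ∑ i, ((∫ ω, (N.storage c.u (t + 1) ω i + Γ i) ^ 2 / 2 ∂μ) / W i -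
        (∫ ω, (N.storage c.u t ω i + Γ i) ^ 2 / 2 ∂μ) / W i +
        N.lam i / W i * (∫ ω, N.storage c.u t ω i ∂μ + Γ i) *
          ((1 / (T : ℝ)) * ∑ τ ∈ Finset.range T, ∫ ω, c'.u τ ω i ∂μ)) ≤
      ∑ i, (N.M i (Γ i) / W i + (|N.Smin i + Γ i| + |N.Smax i + Γ i|) *
        (N.Smax i - N.Smin i) / W i / T +
        N.lam i / W i * ∫ ω, (N.storage c.u t ω i + Γ i) * c.u t ω i ∂μ) := by
    refine Finset.sum_le_sum fun i _ => ?_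
    obtain ⟨s', hs', hv⟩ := hc'.exists_average_control hT i
    have h1 := Mu_add_le (γ := Γ i) (hadm.integral_storage_mem t i) hs' hv
    have h2 := hadm.integral_sq_drift_le Γ t i
    have h3 := div_le_div_of_nonneg_right (add_le_add h1 h2) (hW i).le
    rw [← sub_nonneg] at h3 ⊢
    refine h3.trans_eq ?_
    ring
  simp only [Finset.sum_add_distrib, Finset.sum_sub_distrib, ← Finset.sum_div] at hbus hle ⊢
  linarith

/-- Summing `IsOMG.cost_add_drift_le` over the periods of the greedy policy, the drift telescopes
and its contribution to the average vanishes. -/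
lemma IsOMG.longRunCost_le_averageCost [IsProbabilityMeasure μ]
    (hN : N.FeasibleControllable) (hiid : N.IIDDisturbances μ ℱ δ p)
    (hint : ∀ i r, Integrable (fun ω => N.g i r (p 0 ω i)) μ) (hW : ∀ i, 0 < W i)
    (hc : N.IsOMG μ ℱ δ p W Γ c) (hadm : N.Admissible μ ℱ δ c) (hc' : N.Admissible μ ℱ δ c')
    {T : ℕ} (hT : 0 < T) :
    N.longRunCost μ p c ≤ ((∑ i, N.M i (Γ i) / W i + N.averageCost μ p c' T +
      (∑ i, (|N.Smin i + Γ i| + |N.Smax i + Γ i|) * (N.Smax i - N.Smin i) / W i) / T : ℝ) :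
        EReal) := by
  set K := ∑ i, N.M i (Γ i) / W i + N.averageCost μ p c' T +
      (∑ i, (|N.Smin i + Γ i| + |N.Smax i + Γ i|) * (N.Smax i - N.Smin i) / W i) / T
  set Φ : ℕ → ℝ := fun t => ∑ i, (∫ ω, (N.storage c.u t ω i + Γ i) ^ 2 / 2 ∂μ) / W i
  have hΦ : ∀ t, 0 ≤ Φ t := fun t => Finset.sum_nonneg fun i _ =>
    div_nonneg (integral_nonneg fun ω => by positivity) (hW i).le
  have havg : ∀ T' : ℕ, 0 < T' → N.averageCost μ p c T' ≤ K + Φ 0 / T' := by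
    intro T' hT'
    have hpos : (0 : ℝ) < T' := Nat.cast_pos.2 hT'
    have h := Finset.sum_le_card_nsmul (Finset.range T') _ _ fun t _ =>
      hc.cost_add_drift_le hN hiid hint hW hadm hc' t hT
    rw [Finset.sum_add_distrib, Finset.sum_range_sub Φ, Finset.card_range, nsmul_eq_mul] at h
    rw [hadm.averageCost_eq hiid hint, one_div_mul_eq_div, div_le_iff₀ hpos, add_mul,
      div_mul_cancel₀ _ hpos.ne']
    linarith [hΦ T', mul_comm K T']
  have hlim : Tendsto (fun T' : ℕ => ((K + Φ 0 / T' : ℝ) : EReal)) atTop (nhds (K : EReal)) := by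
    refine (continuous_coe_real_ereal.tendsto K).comp ?_
    simpa using (tendsto_const_div_atTop_nhds_zero_nat (Φ 0)).const_add K
  rw [longRunCost, ← hlim.limsup_eq]
  refine limsup_le_limsup ?_
  filter_upwards [eventually_gt_atTop 0] with T' hT' using EReal.coe_le_coe_iff.2 (havg T' hT')

lemma IsOMG.longRunCost_le_optimalCost [IsProbabilityMeasure μ]
    (hN : N.FeasibleControllable) (hiid : N.IIDDisturbances μ ℱ δ p)
    (hint : ∀ i r, Integrable (fun ω => N.g i r (p 0 ω i)) μ) (hW : ∀ i, 0 < W i)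
    (hc : N.IsOMG μ ℱ δ p W Γ c) (hadm : N.Admissible μ ℱ δ c) :
    N.longRunCost μ p c ≤
      N.optimalCost μ ℱ δ p + ((∑ i, N.M i (Γ i) / W i : ℝ) : EReal) := by
  set K : ℝ := ∑ i, N.M i (Γ i) / W i
  set C : ℝ := ∑ i, (|N.Smin i + Γ i| + |N.Smax i + Γ i|) * (N.Smax i - N.Smin i) / W i
  rw [← EReal.sub_le_iff_le_add (.inl (EReal.coe_ne_bot _)) (.inl (EReal.coe_ne_top _)),
    optimalCost]
  refine le_iInf₂ fun c' hc' => ?_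
  refine EReal.le_of_forall_lt_iff_le.1 fun b hb => ?_
  -- the average costs of the competitor are eventually below `b`
  have hev : ∀ᶠ T : ℕ in atTop, N.longRunCost μ p c ≤ ((K + b + C / T : ℝ) : EReal) := by
    filter_upwards [eventually_lt_of_limsup_lt hb, eventually_gt_atTop 0] with T hTb hT
    refine (hc.longRunCost_le_averageCost hN hiid hint hW hadm hc' hT).trans
      (EReal.coe_le_coe_iff.2 ?_)
    linarith [EReal.coe_lt_coe_iff.1 hTb]
  have hlim : Tendsto (fun T : ℕ => ((K + b + C / T : ℝ) : EReal)) atTop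
      (nhds ((K + b : ℝ) : EReal)) := by
    refine (continuous_coe_real_ereal.tendsto (K + b)).comp ?_
    simpa using (tendsto_const_div_atTop_nhds_zero_nat C).const_add (K + b)
  refine EReal.sub_le_of_le_add ((ge_of_tendsto hlim hev).trans_eq ?_)
  rw [EReal.coe_add, add_comm]

end StorageNetwork

theorem mainTheorem1 {n : ℕ} (N : StorageNetwork n) (hN : N.FeasibleControllable)
    {Ω : Type*} {mΩ : MeasurableSpace Ω} (μ : Measure Ω) [IsProbabilityMeasure μ]
    (ℱ : Filtration ℕ mΩ) (δ p : ℕ → Ω → Fin n → ℝ)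
    (hiid : N.IIDDisturbances μ ℱ δ p)
    (hint : ∀ i r, Integrable (fun ω => N.g i r (p 0 ω i)) μ)
    (Dlo Dup : Fin n → ℝ)
    (hDlo : ∀ i, Dlo i ∈ lowerBounds (N.subgradients i))
    (hDup : ∀ i, Dup i ∈ upperBounds (N.subgradients i))
    (W Γ : Fin n → ℝ)
    (hWpos : ∀ i, 0 < W i)
    (hWmax : ∀ i, (W i : EReal) ≤ N.Wmax i (Dlo i) (Dup i))
    (hΓmin : ∀ i, N.Γmin i (Dlo i) (W i) ≤ Γ i)
    (hΓmax : ∀ i, Γ i ≤ N.Γmax i (Dup i) (W i)) :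
    -- the online program always has an optimal solution
    (∀ s δ₀ p₀ : Fin n → ℝ, (∀ i, p₀ i ∈ Icc (N.Pmin i) (N.Pmax i)) →
      ∃ d, N.IsOnlineSolution W Γ s δ₀ p₀ d) ∧
    ∀ c : ControlProcess n Ω, N.IsOMG μ ℱ δ p W Γ c →
      -- the storage levels stay within their bounds
      (∀ᵐ ω ∂μ, ∀ t i, N.storage c.u t ω i ∈ Icc (N.Smin i) (N.Smax i)) ∧
      -- so that the policy is feasible for the stochastic network storage problem
      N.Admissible μ ℱ δ c ∧
      -- its expected costs are finite
      (∀ t i, Integrable (fun ω => N.g i (c.r t ω i) (p t ω i)) μ) ∧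
      -- and its long-run average cost is near-optimal
      N.longRunCost μ p c ≤
        N.optimalCost μ ℱ δ p + ((∑ i, N.M i (Γ i) / W i : ℝ) : EReal) := by
  refine ⟨fun s δ₀ p₀ hp₀ => StorageNetwork.exists_isOnlineSolution hN hp₀, fun c hc => ?_⟩
  have hmem := hc.ae_storage_mem hN hiid hDlo hDup hWpos hΓmin hΓmax
  have hadm : N.Admissible μ ℱ δ c :=
    { adapted := hc.adapted
      feasible := fun t => (hc.solves t).mono fun ω hω => hω.1
      storage_mem := ae_all_iff.1 hmem }
  exact ⟨hmem, hadm,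
    fun t => StorageNetwork.integrable_cost hiid hint hc.adapted (hadm.feasible t),
    hc.longRunCost_le_optimalCost hN hiid hint hWpos hadm⟩
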